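/- Let $\mathcal L_{PA}$ be the language with $0$, $S$, $+$, $\times$. Fix a standard arithmetisation of the syntax of $\mathcal L_{PA}$-formulas built from equations with $\neg,\vee,\exists$ (so that $\varphi\wedge\psi$ abbreviates $\neg(\neg\varphi\vee\neg\psi)$ and $\varphi\to\psi$ abbreviates $\neg\varphi\vee\psi$). A model of $\mathrm{CT}^-$ is a pair $(M,T)$ with $M\models\mathrm{PA}$ and $T\subseteq M$ such that, in the sense of $M$: 1. for all closed terms $s,t$: $T(s=t)$ iff $s$ and $t$ have the same value; 2. for all sentences $\varphi$: $T(\neg\varphi)$ iff not $T(\varphi)$; 3. for all sentences $\varphi,\psi$: $T(\varphi\vee\psi)$ iff $T(\varphi)$ or $T(\psi)$; 4. for all variables $v$ and formulas $\varphi$ with at most one free variable: $T(\exists v\,\varphi)$ iff $T(\varphi[\underline{x}/v])$ for some $x\in M$, where $\underline{x}$ is the numeral of $x$; 5. for all formulas $\varphi$ and all coded sequences $\bar s,\bar t$ of closed terms, of the same length, that are substituted for the free variables of $\varphi$: if $\bar s$ and $\bar t$ have termwise equal values, then $T(\varphi(\bar s))$ iff $T(\varphi(\bar t))$. No induction is assumed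 for formulas that contain $T$. Let $(M,T)\models\mathrm{CT}^-$, let $c\in M$, and let $(\alpha_i)_{i\le c}$, $(\beta_i)_{i\le c}$ be sequences, coded in $M$, of sentences in the sense of $M$. The disjunction with stopping condition $\bigvee_{i=a}^{c,\alpha}\beta_i$ is defined inside $M$, for $a\le c$, by backward recursion on $a$: $$\bigvee_{i=c}^{c,\alpha}\beta_i=(\alpha_c\wedge\beta_c),\qquad \bigvee_{i=a}^{c,\alpha}\beta_i=(\alpha_a\to\beta_a)\wedge\Big[(\alpha_a\wedge\beta_a)\vee\big(\neg\alpha_a\wedge\bigvee_{i=a+1}^{c,\alpha}\beta_i\big)\Big]\quad(a<c);$$ that is, it is the $a$-th element of a sequence coded in $M$ that satisfies these equations. **Theorem.** For every $a\le c$ the element $\bigvee_{i=a}^{c,\alpha}\beta_i$ of $M$ exists and is unique. Suppose that there is a least $k_0\le c$ such that $T(\alpha_{k_0})$ holds in $(M,T)$, and that this $k_0$ is standard. Then $$(M,T)\models\; T\Big(\bigvee_{i=0}^{c,\alpha}\beta_i\Big)\equiv T(\beta_{k_0}).$$ -/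

import Mathlib

open FirstOrder FirstOrder.Language

universe u

/-! ### The language and the axioms of Peano arithmetic -/

/-- Function symbols `0`, `S`, `+`, `×`. -/
inductive LPAFunc : ℕ → Type
  | zero : LPAFunc 0
  | succ : LPAFunc 1
  | add : LPAFunc 2
  | mul : LPAFunc 2

/-- The language of Peano arithmetic (equality is the only relation symbol). -/
def LPA : FirstOrder.Language.{0, 0} := ⟨LPAFunc, fun _ => Empty⟩

namespace PA

abbrev fZero : LPA.Functions 0 := LPAFunc.zero

abbrev fSucc : LPA.Functions 1 := LPAFunc.succ

abbrev fAdd : LPA.Functions 2 := LPAFunc.add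

abbrev fMul : LPA.Functions 2 := LPAFunc.mul

def tZero {γ : Type} : LPA.Term γ := Term.func fZero ![]

def tSucc {γ : Type} (t : LPA.Term γ) : LPA.Term γ := Term.func fSucc ![t]

def tAdd {γ : Type} (t s : LPA.Term γ) : LPA.Term γ := Term.func fAdd ![t, s]

def tMul {γ : Type} (t s : LPA.Term γ) : LPA.Term γ := Term.func fMul ![t, s]

def axSuccNeZero : LPA.Sentence :=
  ∀' ∼((tSucc &0).bdEqual tZero)

def axSuccInj : LPA.Sentence :=
  ∀' ∀' (((tSucc &0).bdEqual (tSucc &1)) ⟹ ((&0 : LPA.Term (Empty ⊕ Fin 2)).bdEqual &1))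

def axAddZero : LPA.Sentence :=
  ∀' ((tAdd &0 tZero).bdEqual &0)

def axAddSucc : LPA.Sentence :=
  ∀' ∀' ((tAdd &0 (tSucc &1)).bdEqual (tSucc (tAdd &0 &1)))

def axMulZero : LPA.Sentence :=
  ∀' ((tMul &0 tZero).bdEqual tZero)

def axMulSucc : LPA.Sentence :=
  ∀' ∀' ((tMul &0 (tSucc &1)).bdEqual (tAdd (tMul &0 &1) &0))

/-- `φ(p, 0) ∧ ∀ x (φ(p, x) → φ(p, S x)) → ∀ x φ(p, x)`, with parameters `p = (p_0, …, p_{n-1})`. -/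
noncomputable def inductionFormula {n : ℕ} (φ : LPA.Formula (Fin n ⊕ Unit)) :
    LPA.Formula (Fin n) :=
  let base : LPA.Formula (Fin n) :=
    BoundedFormula.subst φ (Sum.elim (fun i => Term.var i) (fun _ => tZero))
  let next : LPA.Formula (Fin n ⊕ Unit) :=
    BoundedFormula.subst φ
      (Sum.elim (fun i => Term.var (Sum.inl i)) (fun j => tSucc (Term.var (Sum.inr j))))
  (base ⊓ Formula.iAlls Unit (φ.imp next)).imp (Formula.iAlls Unit φ)

/-- The universal closure of the induction axiom for `φ`. -/
noncomputable def axInduction {n : ℕ} (φ : LPA.Formula (Fin n ⊕ Unit)) : LPA.Sentence :=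
  Formula.iAlls (Fin n) ((inductionFormula φ).relabel (Sum.inr : Fin n → Empty ⊕ Fin n))

end PA

/-- Peano arithmetic. -/
def PeanoArithmetic : LPA.Theory :=
  {PA.axSuccNeZero, PA.axSuccInj, PA.axAddZero, PA.axAddSucc, PA.axMulZero, PA.axMulSucc} ∪
    {σ | ∃ (n : ℕ) (φ : LPA.Formula (Fin n ⊕ Unit)), σ = PA.axInduction φ}

/-! ### Arithmetic inside a structure

All predicates below are spelled out with quantifiers over elements of `M` only, so each of them
is the interpretation in `M` of an arithmetical formula. -/

namespace PA

variable {M : Type u} [LPA.Structure M]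

def zero : M := Structure.funMap fZero ![]

def succ (x : M) : M := Structure.funMap fSucc ![x]

def add (x y : M) : M := Structure.funMap fAdd ![x, y]

def mul (x y : M) : M := Structure.funMap fMul ![x, y]

def le (x y : M) : Prop := ∃ z, add x z = y

def lt (x y : M) : Prop := ∃ z, add x (succ z) = y

/-- The element `S … S 0` of `M`, with `n` occurrences of `S`. -/
def std : ℕ → M
  | 0 => zero
  | n + 1 => succ (std n)

def IsStandard (x : M) : Prop := ∃ n : ℕ, std n = x

/-- The injective pairing `⟨x, y⟩ = (x + y)² + x`. -/
def pair (x y : M) : M := add (mul (add x y) (add x y)) x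

/-- `Elem s i z`: the `i`-th element of the sequence coded by `s` is `z`. This is Gödel's
`β`-function: for `s = ⟨a, b⟩`, `z` is the remainder of `a` modulo `1 + (i + 1) b`. -/
def Elem (s i z : M) : Prop :=
  ∃ a b q, s = pair a b ∧ a = add (mul q (succ (mul (succ i) b))) z ∧
    lt z (succ (mul (succ i) b))

/-- The sequence `(f i)_{i ≤ c}` is coded in `M`. Only the values `f i` with `i ≤ c` matter. -/
def CodedSeq (c : M) (f : M → M) : Prop := ∃ s, ∀ i, le i c → Elem s i (f i)

/-- `x` is the last term of a coded sequence `s_0, …, s_l` of `M` each term of which is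
obtained, by the rules `step`, from earlier terms of the sequence. -/
def Gen (step : (M → Prop) → M → Prop) (x : M) : Prop :=
  ∃ s l, Elem s l x ∧
    ∀ i, le i l → ∃ y, Elem s i y ∧ step (fun z => ∃ j, lt j i ∧ Elem s j z) y

/-! ### Arithmetised syntax: codes of terms and formulas -/

def cZero : M := pair (std 1) zero

/-- The variable with index `v`. -/
def cVar (v : M) : M := pair (std 2) v

def cSucc (t : M) : M := pair (std 3) t

def cAdd (t u : M) : M := pair (std 4) (pair t u)

def cMul (t u : M) : M := pair (std 5) (pair t u)

def cEq (t u : M) : M := pair (std 6) (pair t u)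

def cNeg (φ : M) : M := pair (std 7) φ

def cOr (φ ψ : M) : M := pair (std 8) (pair φ ψ)

/-- `∃ v φ`, where `v` is the index of the quantified variable. -/
def cEx (v φ : M) : M := pair (std 9) (pair v φ)

def cAnd (φ ψ : M) : M := cNeg (cOr (cNeg φ) (cNeg ψ))

def cImp (φ ψ : M) : M := cOr (cNeg φ) ψ

/-- `t` is (the code in `M` of) a term. -/
def IsTerm (t : M) : Prop :=
  Gen (fun P y => y = cZero ∨ (∃ v, y = cVar v) ∨ (∃ t, P t ∧ y = cSucc t) ∨
    (∃ t u, P t ∧ P u ∧ y = cAdd t u) ∨ (∃ t u, P t ∧ P u ∧ y = cMul t u)) t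

/-- `t` is a closed term. -/
def IsClTerm (t : M) : Prop :=
  Gen (fun P y => y = cZero ∨ (∃ t, P t ∧ y = cSucc t) ∨
    (∃ t u, P t ∧ P u ∧ y = cAdd t u) ∨ (∃ t u, P t ∧ P u ∧ y = cMul t u)) t

/-- `φ` is a formula. -/
def IsForm (φ : M) : Prop :=
  Gen (fun P y => (∃ t u, IsTerm t ∧ IsTerm u ∧ y = cEq t u) ∨ (∃ φ, P φ ∧ y = cNeg φ) ∨
    (∃ φ ψ, P φ ∧ P ψ ∧ y = cOr φ ψ) ∨ (∃ v φ, P φ ∧ y = cEx v φ)) φ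

/-- The variable with index `v` occurs in the term `t`. -/
def OccursIn (v t : M) : Prop :=
  Gen (fun P y => y = cVar v ∨ (∃ t, P t ∧ y = cSucc t) ∨
    (∃ t u, (P t ∨ P u) ∧ y = cAdd t u) ∨ (∃ t u, (P t ∨ P u) ∧ y = cMul t u)) t

/-- The variable with index `v` occurs free in the formula `φ`. -/
def FreeIn (v φ : M) : Prop :=
  Gen (fun P y => (∃ t u, (OccursIn v t ∨ OccursIn v u) ∧ y = cEq t u) ∨
    (∃ φ, P φ ∧ y = cNeg φ) ∨ (∃ φ ψ, (P φ ∨ P ψ) ∧ y = cOr φ ψ) ∨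
    (∃ w φ, w ≠ v ∧ P φ ∧ y = cEx w φ)) φ

/-- `φ` is a sentence. -/
def IsSent (φ : M) : Prop := IsForm φ ∧ ∀ v, ¬ FreeIn v φ

/-- `φ` is a formula with at most one free variable. -/
def IsForm1 (φ : M) : Prop := IsForm φ ∧ ∀ v w, FreeIn v φ → FreeIn w φ → v = w

/-- `t` is the numeral `S … S 0` denoting `x`. -/
def IsNumeral (x t : M) : Prop :=
  Gen (fun P y => y = pair zero cZero ∨ (∃ x t, P (pair x t) ∧ y = pair (succ x) (cSucc t)))
    (pair x t)

/-- `x` is the value of the closed term `t`. -/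
def HasVal (t x : M) : Prop :=
  Gen (fun P y => y = pair cZero zero ∨ (∃ t x, P (pair t x) ∧ y = pair (cSucc t) (succ x)) ∨
    (∃ t x u z, P (pair t x) ∧ P (pair u z) ∧ y = pair (cAdd t u) (add x z)) ∨
    (∃ t x u z, P (pair t x) ∧ P (pair u z) ∧ y = pair (cMul t u) (mul x z))) (pair t x)

def SameVal (s t : M) : Prop := ∃ x, HasVal s x ∧ HasVal t x

/-- `u'` is the result of substituting the term `t` for the variable `v` in the term `u`. -/
def TermSubst (v t u u' : M) : Prop :=
  Gen (fun P y => y = pair cZero cZero ∨ y = pair (cVar v) t ∨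
    (∃ w, w ≠ v ∧ y = pair (cVar w) (cVar w)) ∨
    (∃ a a', P (pair a a') ∧ y = pair (cSucc a) (cSucc a')) ∨
    (∃ a a' b b', P (pair a a') ∧ P (pair b b') ∧ y = pair (cAdd a b) (cAdd a' b')) ∨
    (∃ a a' b b', P (pair a a') ∧ P (pair b b') ∧ y = pair (cMul a b) (cMul a' b'))) (pair u u')

/-- `φ'` is the result of substituting the closed term `t` for the free occurrences of the
variable `v` in the formula `φ`. -/
def FormSubst (v t φ φ' : M) : Prop :=
  Gen (fun P y =>
    (∃ a a' b b', TermSubst v t a a' ∧ TermSubst v t b b' ∧ y = pair (cEq a b) (cEq a' b')) ∨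
    (∃ φ φ', P (pair φ φ') ∧ y = pair (cNeg φ) (cNeg φ')) ∨
    (∃ φ φ' ψ ψ', P (pair φ φ') ∧ P (pair ψ ψ') ∧ y = pair (cOr φ ψ) (cOr φ' ψ')) ∨
    (∃ w φ φ', w ≠ v ∧ P (pair φ φ') ∧ y = pair (cEx w φ) (cEx w φ')) ∨
    (∃ φ, IsForm φ ∧ y = pair (cEx v φ) (cEx v φ))) (pair φ φ')

/-- `ψ` is the result of substituting the closed terms `t_0, …, t_{l-1}` (where `t_i` is the `i`-th
element of the sequence `t`) for the variables with indices `0, …, l - 1` in `φ`. The terms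
being closed, the simultaneous substitution may be carried out one variable at a time. -/
def SeqSubst (l t φ ψ : M) : Prop :=
  ∃ r, Elem r zero φ ∧ Elem r l ψ ∧
    ∀ i, lt i l → ∃ x y u, Elem r i x ∧ Elem r (succ i) y ∧ Elem t i u ∧ FormSubst i u x y

/-- `(M, T)` is a model of `CT⁻`, the compositional theory of truth over Peano arithmetic. -/
structure IsCTMinus (M : Type u) [LPA.Structure M] (T : Set M) : Prop where
  pa : M ⊨ PeanoArithmetic
  eq : ∀ s t : M, IsClTerm s → IsClTerm t → (cEq s t ∈ T ↔ SameVal s t)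
  neg : ∀ φ : M, IsSent φ → (cNeg φ ∈ T ↔ φ ∉ T)
  or : ∀ φ ψ : M, IsSent φ → IsSent ψ → (cOr φ ψ ∈ T ↔ φ ∈ T ∨ ψ ∈ T)
  ex : ∀ v φ : M, IsForm1 φ →
    (cEx v φ ∈ T ↔ ∃ x t ψ, IsNumeral x t ∧ FormSubst v t φ ψ ∧ ψ ∈ T)
  regularity : ∀ l s t φ φs φt : M,
    (∀ i, lt i l → ∃ a b, Elem s i a ∧ Elem t i b ∧ IsClTerm a ∧ IsClTerm b ∧ SameVal a b) →
    IsForm φ → (∀ v, FreeIn v φ → lt v l) → SeqSubst l s φ φs → SeqSubst l t φ φt →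
    (φs ∈ T ↔ φt ∈ T)

/-- `δ` is the disjunction with stopping condition `⋁_{i=a}^{c,α} β_i`: it is the `a`-th element
of a coded sequence `(d i)_{i ≤ c}` of `M` that satisfies the backward recursion
`d c = α_c ∧ β_c` and, for `i < c`,
`d i = (α_i → β_i) ∧ ((α_i ∧ β_i) ∨ (¬ α_i ∧ d (i + 1)))`. -/
def IsStoppingDisj (c : M) (α β : M → M) (a δ : M) : Prop :=
  ∃ d : M → M, CodedSeq c d ∧ d c = cAnd (α c) (β c) ∧
    (∀ i, lt i c → d i = cAnd (cImp (α i) (β i))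
      (cOr (cAnd (α i) (β i)) (cAnd (cNeg (α i)) (d (succ i))))) ∧
    d a = δ

end PA

/-!
Since `T` is not subject to induction in `M`, everything which involves the nonstandard length `c`
has to be settled by arithmetical means. Backward recursion along `c` is carried out inside `M`:
Gödel's `β`-function, available through the Chinese remainder theorem, codes every definable
sequence, so that a partial recursion can be prolonged by one step and definable induction applies.
Uniqueness, and the fact that every `⋁_{i=a}^{c,α} β_i` is a sentence, are arithmetical properties
as well. Only then does truth enter: where `α_i` is false the recursion step has the same truth
value as its successor, and where `α_i` is true it has that of `β_i`. Starting from `0` one reaches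
`k₀` in finitely many steps because `k₀` is standard.
-/

namespace PA

section Definability

variable {L : FirstOrder.Language} {M : Type*} [L.Structure M] {α : Type*}

variable (L) in
/-- `f` is first-order definable with arbitrary parameters from `M`. Being a class, it lets
instance search do the closure properties. -/
class DefinableFun (f : (α → M) → M) : Prop where
  out : (Set.univ : Set M).DefinableFun L f

variable (L) in
/-- `P` is first-order definable with arbitrary parameters from `M`; see `DefinableFun`. -/
class DefinablePred (P : (α → M) → Prop) : Prop where
  out : (Set.univ : Set M).Definable L {v | P v}

instance DefinableFun.const (a : M) : DefinableFun L fun _ : α → M => a :=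
  ⟨L.definableFun_const α (Set.mem_univ a)⟩

instance DefinableFun.proj (i : α) : DefinableFun L fun v : α → M => v i :=
  ⟨Set.DefinableFun.proj L⟩

theorem DefinableFun.of_graph {f : (α → M) → M}
    (hf : DefinablePred L fun w : Option α → M => f (fun i => w (some i)) = w none) :
    DefinableFun L f :=
  ⟨hf.out⟩

theorem DefinableFun.comp {n : ℕ} {F : (Fin n → M) → M} (hF : DefinableFun L F)
    {f : Fin n → (α → M) → M} (hf : ∀ i, DefinableFun L (f i)) :
    DefinableFun L fun v => F fun i => f i v :=
  ⟨Set.DefinableFun.comp (fun i => (hf i).out) hF.out⟩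

theorem DefinableFun.comp₁ {F : M → M} (hF : DefinableFun L fun v : Fin 1 → M => F (v 0))
    (f : (α → M) → M) [hf : DefinableFun L f] : DefinableFun L fun v => F (f v) :=
  hF.comp (f := ![f]) fun i => by fin_cases i; exact hf

theorem DefinableFun.comp₂ {F : M → M → M}
    (hF : DefinableFun L fun v : Fin 2 → M => F (v 0) (v 1)) (f g : (α → M) → M)
    [hf : DefinableFun L f] [hg : DefinableFun L g] : DefinableFun L fun v => F (f v) (g v) :=
  hF.comp (f := ![f, g]) fun i => by fin_cases i; exacts [hf, hg]

theorem DefinablePred.comp {n : ℕ} {P : (Fin n → M) → Prop} (hP : DefinablePred L P)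
    {f : Fin n → (α → M) → M} (hf : ∀ i, DefinableFun L (f i)) :
    DefinablePred L fun v => P fun i => f i v :=
  ⟨Set.Definable.preimage_map (F := fun v i => f i v) (fun i => (hf i).out) hP.out⟩

theorem DefinablePred.comp₁ {P : M → Prop} (hP : DefinablePred L fun v : Fin 1 → M => P (v 0))
    (f : (α → M) → M) [hf : DefinableFun L f] : DefinablePred L fun v => P (f v) :=
  hP.comp (f := ![f]) fun i => by fin_cases i; exact hf

theorem DefinablePred.comp₂ {P : M → M → Prop}
    (hP : DefinablePred L fun v : Fin 2 → M => P (v 0) (v 1)) (f g : (α → M) → M)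
    [hf : DefinableFun L f] [hg : DefinableFun L g] : DefinablePred L fun v => P (f v) (g v) :=
  hP.comp (f := ![f, g]) fun i => by fin_cases i; exacts [hf, hg]

theorem DefinablePred.comp₃ {P : M → M → M → Prop}
    (hP : DefinablePred L fun v : Fin 3 → M => P (v 0) (v 1) (v 2)) (f g h : (α → M) → M)
    [hf : DefinableFun L f] [hg : DefinableFun L g] [hh : DefinableFun L h] :
    DefinablePred L fun v => P (f v) (g v) (h v) :=
  hP.comp (f := ![f, g, h]) fun i => by fin_cases i; exacts [hf, hg, hh]

instance DefinablePred.eq (f g : (α → M) → M) [hf : DefinableFun L f] [hg : DefinableFun L g] :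
    DefinablePred L fun v => f v = g v :=
  ⟨hf.out.ofPred_eq hg.out⟩

instance DefinablePred.not (P : (α → M) → Prop) [hP : DefinablePred L P] :
    DefinablePred L fun v => ¬ P v :=
  ⟨hP.out.compl⟩

instance DefinablePred.ne (f g : (α → M) → M) [DefinableFun L f] [DefinableFun L g] :
    DefinablePred L fun v => f v ≠ g v :=
  DefinablePred.not fun v => f v = g v

instance DefinablePred.and (P Q : (α → M) → Prop) [hP : DefinablePred L P]
    [hQ : DefinablePred L Q] : DefinablePred L fun v => P v ∧ Q v :=
  ⟨hP.out.inter hQ.out⟩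

instance DefinablePred.or (P Q : (α → M) → Prop) [hP : DefinablePred L P]
    [hQ : DefinablePred L Q] : DefinablePred L fun v => P v ∨ Q v :=
  ⟨hP.out.union hQ.out⟩

instance DefinablePred.imp (P Q : (α → M) → Prop) [hP : DefinablePred L P]
    [hQ : DefinablePred L Q] : DefinablePred L fun v => P v → Q v :=
  ⟨hP.out.himp hQ.out⟩

instance DefinablePred.exists (P : (α → M) → M → Prop)
    [hP : DefinablePred L fun w : α ⊕ Unit → M => P (fun i => w (Sum.inl i)) (w (Sum.inr ()))] :
    DefinablePred L fun v => ∃ x, P v x := by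
  refine ⟨?_⟩
  convert hP.out.exists_of_finite with v
  exact ⟨fun ⟨x, hx⟩ => ⟨fun _ => x, hx⟩, fun ⟨u, hu⟩ => ⟨u (), hu⟩⟩

instance DefinablePred.forall (P : (α → M) → M → Prop)
    [hP : DefinablePred L fun w : α ⊕ Unit → M => P (fun i => w (Sum.inl i)) (w (Sum.inr ()))] :
    DefinablePred L fun v => ∀ x, P v x := by
  refine ⟨?_⟩
  convert hP.out.forall_of_finite with v
  exact ⟨fun h u => h (u ()), fun h x => h fun _ => x⟩

instance DefinableFun.ite (P : (α → M) → Prop) [DecidablePred P] (f g : (α → M) → M)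
    [hP : DefinablePred L P] [hf : DefinableFun L f] [hg : DefinableFun L g] :
    DefinableFun L fun v => if P v then f v else g v :=
  ⟨hf.out.ite hP.out hg.out⟩

end Definability

section Models

variable {M : Type*} [LPA.Structure M]

theorem realize_tZero {γ : Type} (v : γ → M) : (tZero : LPA.Term γ).realize v = zero := by
  simp only [tZero, Term.realize_func, zero]
  exact congrArg _ (Subsingleton.elim (α := Fin 0 → M) _ _)

theorem realize_tSucc {γ : Type} (v : γ → M) (t : LPA.Term γ) :
    (tSucc t).realize v = succ (t.realize v) := by
  simp only [tSucc, Term.realize_func, succ]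
  congr 1; funext i; fin_cases i; rfl

theorem realize_tAdd {γ : Type} (v : γ → M) (t s : LPA.Term γ) :
    (tAdd t s).realize v = add (t.realize v) (s.realize v) := by
  simp only [tAdd, Term.realize_func, add]
  congr 1; funext i; fin_cases i <;> rfl

theorem realize_tMul {γ : Type} (v : γ → M) (t s : LPA.Term γ) :
    (tMul t s).realize v = mul (t.realize v) (s.realize v) := by
  simp only [tMul, Term.realize_func, mul]
  congr 1; funext i; fin_cases i <;> rfl

theorem realize_subst {γ δ : Type} (φ : LPA.Formula γ) (f : γ → LPA.Term δ) (v : δ → M) :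
    Formula.Realize (BoundedFormula.subst φ f) v ↔ φ.Realize fun a => (f a).realize v :=
  BoundedFormula.realize_subst

theorem realize_inductionFormula {n : ℕ} (φ : LPA.Formula (Fin n ⊕ Unit)) (p : Fin n → M) :
    (inductionFormula φ).Realize p ↔
      (φ.Realize (Sum.elim p fun _ => zero) ∧
        (∀ x, φ.Realize (Sum.elim p fun _ => x) → φ.Realize (Sum.elim p fun _ => succ x)) →
      ∀ x, φ.Realize (Sum.elim p fun _ => x)) := by
  have forall_unit {Q : (Unit → M) → Prop} : (∀ y, Q y) ↔ ∀ x, Q fun _ => x :=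
    ⟨fun h x => h _, fun h y => h (y ())⟩
  have zero_assignment : (fun a => (Sum.elim (fun i => Term.var i) (fun _ => tZero) a :
      LPA.Term (Fin n)).realize p) = Sum.elim p fun _ : Unit => zero := by
    ext (i | _) <;> simp [realize_tZero]
  have succ_assignment (x : M) : (fun a => (Sum.elim (fun i => Term.var (Sum.inl i))
      (fun j => tSucc (Term.var (Sum.inr j))) a : LPA.Term (Fin n ⊕ Unit)).realize
        (Sum.elim p fun _ => x)) = Sum.elim p fun _ => succ x := by
    ext (i | _) <;> simp [realize_tSucc]
  simp only [inductionFormula, Formula.realize_imp, Formula.realize_inf, Formula.realize_iAlls,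
    forall_unit, realize_subst, zero_assignment, succ_assignment]

variable [hM : M ⊨ PeanoArithmetic]

theorem realize_induction {n : ℕ} (φ : LPA.Formula (Fin n ⊕ Unit)) (p : Fin n → M)
    (zero : φ.Realize (Sum.elim p fun _ => zero))
    (succ : ∀ x, φ.Realize (Sum.elim p fun _ => x) → φ.Realize (Sum.elim p fun _ => succ x))
    (x : M) : φ.Realize (Sum.elim p fun _ => x) := by
  have hax : M ⊨ axInduction φ := hM.realize_of_mem _ (Or.inr ⟨n, φ, rfl⟩)
  rw [axInduction, Sentence.Realize, Formula.realize_iAlls] at hax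
  have h := hax p
  rw [Formula.realize_relabel] at h
  exact (realize_inductionFormula φ p).1 h ⟨zero, succ⟩ x

@[elab_as_elim]
theorem induction {P : M → Prop} [hP : DefinablePred LPA fun v : Fin 1 → M => P (v 0)]
    (zero : P zero) (succ : ∀ x, P x → P (succ x)) (x : M) : P x := by
  obtain ⟨A, -, hA⟩ := Set.definable_iff_finitely_definable.1 hP.out
  obtain ⟨φ, hφ⟩ := Set.definable_iff_exists_formula_sum.1 hA
  let e := A.equivFin
  let p : Fin A.card → M := fun i => e.symm i
  let ψ := φ.relabel (Sum.map e fun _ : Fin 1 => ())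
  have realize_ψ (y : M) : ψ.Realize (Sum.elim p fun _ => y) ↔ P y := by
    have h : P y ↔ φ.Realize (Sum.elim (↑) fun _ => y) :=
      (Set.ext_iff.1 hφ) fun _ => y
    rw [h, Formula.realize_relabel]
    refine iff_of_eq (congrArg φ.Realize ?_)
    ext (a | _) <;> simp [p]
  simp only [← realize_ψ] at zero succ ⊢
  exact realize_induction ψ p zero succ x

end Models

section Arithmetic

variable {M : Type*} [LPA.Structure M] {α : Type*}

theorem DefinableFun.funMap {n : ℕ} (F : LPA.Functions n) (f : (α → M) → Fin n → M)
    (hf : ∀ i, DefinableFun LPA fun v => f v i) :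
    DefinableFun LPA fun v => Structure.funMap F (f v) :=
  DefinableFun.comp ⟨(Set.DefinableFun.fun_symbol F).of_empty⟩ hf

instance DefinableFun.succ (f : (α → M) → M) [hf : DefinableFun LPA f] :
    DefinableFun LPA fun v => succ (f v) :=
  .funMap fSucc _ fun i => by fin_cases i; exact hf

instance DefinableFun.add (f g : (α → M) → M) [hf : DefinableFun LPA f]
    [hg : DefinableFun LPA g] : DefinableFun LPA fun v => add (f v) (g v) :=
  .funMap fAdd _ fun i => by fin_cases i; exacts [hf, hg]

instance DefinableFun.mul (f g : (α → M) → M) [hf : DefinableFun LPA f]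
    [hg : DefinableFun LPA g] : DefinableFun LPA fun v => mul (f v) (g v) :=
  .funMap fMul _ fun i => by fin_cases i; exacts [hf, hg]

instance DefinablePred.le (f g : (α → M) → M) [DefinableFun LPA f] [DefinableFun LPA g] :
    DefinablePred LPA fun v => le (f v) (g v) :=
  .comp₂ (P := PA.le) (by unfold PA.le; infer_instance) f g

instance DefinablePred.lt (f g : (α → M) → M) [DefinableFun LPA f] [DefinableFun LPA g] :
    DefinablePred LPA fun v => lt (f v) (g v) :=
  .comp₂ (P := PA.lt) (by unfold PA.lt; infer_instance) f g

scoped instance : Add M := ⟨add⟩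

scoped instance : Mul M := ⟨mul⟩

scoped instance : Zero M := ⟨zero⟩

scoped instance : One M := ⟨succ zero⟩

theorem add_def (x y : M) : add x y = x + y := rfl

theorem mul_def (x y : M) : mul x y = x * y := rfl

instance DefinableFun.hAdd (f g : (α → M) → M) [DefinableFun LPA f] [DefinableFun LPA g] :
    DefinableFun LPA fun v => f v + g v :=
  DefinableFun.add f g

instance DefinableFun.hMul (f g : (α → M) → M) [DefinableFun LPA f] [DefinableFun LPA g] :
    DefinableFun LPA fun v => f v * g v :=
  DefinableFun.mul f g

variable [hM : M ⊨ PeanoArithmetic]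

theorem succ_ne_zero (x : M) : succ x ≠ zero := by
  have h := hM.realize_of_mem axSuccNeZero (Or.inl (by simp)) x
  rwa [BoundedFormula.realize_not, BoundedFormula.realize_bdEqual, realize_tSucc,
    realize_tZero] at h

theorem succ_injective : Function.Injective (succ : M → M) := by
  intro x y
  have h := hM.realize_of_mem axSuccInj (Or.inl (by simp)) x y
  rwa [BoundedFormula.realize_imp, BoundedFormula.realize_bdEqual, realize_tSucc,
    realize_tSucc] at h

protected theorem add_zero (x : M) : add x zero = x := by
  have h := hM.realize_of_mem axAddZero (Or.inl (by simp)) x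
  rwa [BoundedFormula.realize_bdEqual, realize_tAdd, realize_tZero] at h

theorem add_succ (x y : M) : add x (succ y) = succ (add x y) := by
  have h := hM.realize_of_mem axAddSucc (Or.inl (by simp)) x y
  rwa [BoundedFormula.realize_bdEqual, realize_tAdd, realize_tSucc, realize_tSucc,
    realize_tAdd] at h

protected theorem mul_zero (x : M) : mul x zero = zero := by
  have h := hM.realize_of_mem axMulZero (Or.inl (by simp)) x
  rwa [BoundedFormula.realize_bdEqual, realize_tMul, realize_tZero] at h

theorem mul_succ (x y : M) : mul x (succ y) = add (mul x y) x := by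
  have h := hM.realize_of_mem axMulSucc (Or.inl (by simp)) x y
  rwa [BoundedFormula.realize_bdEqual, realize_tMul, realize_tSucc, realize_tAdd,
    realize_tMul] at h

protected theorem zero_add (x : M) : add zero x = x := by
  refine PA.induction ?_ (fun x ih => ?_) x
  · exact PA.add_zero zero
  · rw [add_succ, ih]

theorem succ_add (x y : M) : add (succ x) y = succ (add x y) := by
  refine PA.induction ?_ (fun y ih => ?_) y
  · rw [PA.add_zero, PA.add_zero]
  · rw [add_succ, ih, add_succ]

protected theorem add_comm (x y : M) : add x y = add y x := by
  refine PA.induction ?_ (fun y ih => ?_) y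
  · rw [PA.add_zero, PA.zero_add]
  · rw [add_succ, ih, succ_add]

protected theorem add_assoc (x y z : M) : add (add x y) z = add x (add y z) := by
  refine PA.induction ?_ (fun z ih => ?_) z
  · rw [PA.add_zero, PA.add_zero]
  · rw [add_succ, ih, add_succ, add_succ]

protected theorem zero_mul (x : M) : mul zero x = zero := by
  refine PA.induction ?_ (fun x ih => ?_) x
  · exact PA.mul_zero zero
  · rw [mul_succ, ih, PA.add_zero]

theorem succ_mul (x y : M) : mul (succ x) y = add (mul x y) y := by
  refine PA.induction ?_ (fun y ih => ?_) y
  · rw [PA.mul_zero, PA.mul_zero, PA.add_zero]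
  · rw [mul_succ, ih, mul_succ, add_succ, add_succ, PA.add_assoc, PA.add_assoc, PA.add_comm y x]

protected theorem mul_comm (x y : M) : mul x y = mul y x := by
  refine PA.induction ?_ (fun y ih => ?_) y
  · rw [PA.mul_zero, PA.zero_mul]
  · rw [mul_succ, ih, succ_mul]

protected theorem mul_add (x y z : M) : mul x (add y z) = add (mul x y) (mul x z) := by
  refine PA.induction ?_ (fun z ih => ?_) z
  · rw [PA.add_zero, PA.mul_zero, PA.add_zero]
  · rw [add_succ, mul_succ, mul_succ, ih, PA.add_assoc]

protected theorem mul_assoc (x y z : M) : mul (mul x y) z = mul x (mul y z) := by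
  refine PA.induction ?_ (fun z ih => ?_) z
  · rw [PA.mul_zero, PA.mul_zero, PA.mul_zero]
  · rw [mul_succ, mul_succ, PA.mul_add, ih]

protected theorem mul_one (x : M) : mul x (succ zero) = x := by
  rw [mul_succ, PA.mul_zero, PA.zero_add]

scoped instance : CommSemiring M where
  add_assoc := PA.add_assoc
  zero_add := PA.zero_add
  add_zero := PA.add_zero
  add_comm := PA.add_comm
  left_distrib := PA.mul_add
  right_distrib x y z := by
    change mul (add x y) z = add (mul x z) (mul y z)
    rw [PA.mul_comm, PA.mul_add, PA.mul_comm z x, PA.mul_comm z y]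
  zero_mul := PA.zero_mul
  mul_zero := PA.mul_zero
  mul_assoc := PA.mul_assoc
  one_mul x := (PA.mul_comm _ x).trans (PA.mul_one x)
  mul_one := PA.mul_one
  mul_comm := PA.mul_comm
  nsmul := nsmulRec
  npow := npowRec

theorem succ_def (x : M) : succ x = x + 1 := by
  change _ = add x (succ zero)
  rw [add_succ, PA.add_zero]

theorem std_eq_natCast (n : ℕ) : (std n : M) = n := by
  induction n with
  | zero => exact Nat.cast_zero.symm
  | succ n ih => rw [std, succ_def, ih, Nat.cast_succ]

theorem add_one_ne_zero (x : M) : x + 1 ≠ 0 :=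
  succ_def x ▸ succ_ne_zero x

@[elab_as_elim]
theorem induction_add_one {P : M → Prop} [DefinablePred LPA fun v : Fin 1 → M => P (v 0)]
    (zero : P 0) (add_one : ∀ x, P x → P (x + 1)) (x : M) : P x :=
  PA.induction zero (fun x hx => (succ_def x).symm ▸ add_one x hx) x

theorem eq_zero_or_eq_add_one (x : M) : x = 0 ∨ ∃ y, x = y + 1 := by
  refine induction_add_one ?_ (fun x _ => ?_) x
  · exact Or.inl rfl
  · exact Or.inr ⟨x, rfl⟩

scoped instance : IsRightCancelAdd M where
  add_right_cancel z x y := by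
    change x + z = y + z → x = y
    refine induction_add_one ?_ (fun z ih => ?_) z
    · simp only [add_zero, imp_self]
    · intro h
      rw [← add_assoc, ← add_assoc, ← succ_def, ← succ_def] at h
      exact ih (succ_injective h)

scoped instance : IsCancelAdd M where
  __ := AddCommMagma.IsRightCancelAdd.toIsCancelAdd M

theorem eq_zero_of_add_eq_zero {x y : M} (h : x + y = 0) : y = 0 := by
  obtain rfl | ⟨z, rfl⟩ := eq_zero_or_eq_add_one y
  · rfl
  · exact absurd ((add_assoc x z 1).trans h) (add_one_ne_zero _)

protected theorem le_total (x y : M) : le x y ∨ le y x := by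
  refine induction_add_one ?_ (fun y ih => ?_) y
  · exact Or.inr ⟨x, zero_add x⟩
  · obtain ⟨z, rfl⟩ | ⟨z, rfl⟩ := ih
    · exact Or.inl ⟨z + 1, (add_assoc x z 1).symm⟩
    · obtain rfl | ⟨w, rfl⟩ := eq_zero_or_eq_add_one z
      · exact Or.inl ⟨1, by simp only [add_def, add_zero]⟩
      · exact Or.inr ⟨w, by simp only [add_def]; ring⟩

protected theorem le_antisymm {x y : M} (hxy : le x y) (hyx : le y x) : x = y := by
  obtain ⟨u, rfl⟩ := hxy
  obtain ⟨w, hw⟩ := hyx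
  have huw : w + u = 0 := by
    refine add_left_cancel (a := x) ?_
    rw [add_zero, add_comm w, ← add_assoc]
    exact hw
  rw [eq_zero_of_add_eq_zero huw]
  exact (add_zero x).symm

protected theorem lt_iff_le_not_ge (x y : M) : lt x y ↔ le x y ∧ ¬ le y x := by
  constructor
  · rintro ⟨z, rfl⟩
    refine ⟨⟨succ z, rfl⟩, fun ⟨w, hw⟩ => ?_⟩
    have hzw : w + z + 1 = 0 := by
      refine add_left_cancel (a := x) ?_
      calc x + (w + z + 1) = add (add x (succ z)) w := by
            simp only [succ_def, add_def]; ring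
        _ = x + 0 := hw.trans (add_zero x).symm
    exact add_one_ne_zero _ hzw
  · rintro ⟨⟨z, rfl⟩, h⟩
    obtain rfl | ⟨w, rfl⟩ := eq_zero_or_eq_add_one z
    · exact absurd ⟨0, by simp only [add_def, add_zero]⟩ h
    · exact ⟨w, by rw [succ_def]⟩

noncomputable scoped instance : LinearOrder M where
  le := le
  lt := lt
  le_refl x := ⟨0, add_zero x⟩
  le_trans := by
    rintro x _ _ ⟨u, rfl⟩ ⟨w, rfl⟩
    exact ⟨u + w, (add_assoc x u w).symm⟩
  lt_iff_le_not_ge := PA.lt_iff_le_not_ge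
  le_antisymm _ _ := PA.le_antisymm
  le_total := PA.le_total
  toDecidableLE := Classical.decRel _

theorem le_def (x y : M) : le x y ↔ x ≤ y := Iff.rfl

theorem lt_def (x y : M) : lt x y ↔ x < y := Iff.rfl

instance DefinablePred.hLE (f g : (α → M) → M) [DefinableFun LPA f] [DefinableFun LPA g] :
    DefinablePred LPA fun v => f v ≤ g v :=
  DefinablePred.le f g

instance DefinablePred.hLT (f g : (α → M) → M) [DefinableFun LPA f] [DefinableFun LPA g] :
    DefinablePred LPA fun v => f v < g v :=
  DefinablePred.lt f g

scoped instance : IsOrderedAddMonoid M where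
  add_le_add_left := by
    rintro x _ ⟨u, rfl⟩ z
    exact ⟨u, add_right_comm x z u⟩

scoped instance : CanonicallyOrderedAdd M where
  exists_add_of_le := by
    rintro x _ ⟨u, rfl⟩
    exact ⟨u, rfl⟩
  le_add_self x y := ⟨y, add_comm x y⟩
  le_self_add x y := ⟨y, rfl⟩

scoped instance : Nontrivial M := ⟨⟨1, 0, succ_ne_zero 0⟩⟩

scoped instance : NoZeroDivisors M where
  eq_zero_or_eq_zero_of_mul_eq_zero {x y} h := by
    obtain rfl | ⟨z, rfl⟩ := eq_zero_or_eq_add_one x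
    · exact Or.inl rfl
    · rw [add_mul, one_mul] at h
      exact Or.inr (eq_zero_of_add_eq_zero h)

theorem exists_eq_add_add_one {x y : M} (h : x < y) : ∃ z, y = x + z + 1 := by
  obtain ⟨z, rfl⟩ := h
  exact ⟨z, by rw [add_succ, succ_def]; rfl⟩

protected theorem add_one_le_iff {x y : M} : x + 1 ≤ y ↔ x < y := by
  constructor
  · rintro ⟨z, rfl⟩
    exact ⟨z, by simp only [succ_def, add_def]; ring⟩
  · intro h
    obtain ⟨z, rfl⟩ := exists_eq_add_add_one h
    exact add_le_add_left le_self_add 1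

noncomputable scoped instance : SuccOrder M :=
  SuccOrder.ofSuccLeIff (· + 1) PA.add_one_le_iff

noncomputable scoped instance : SuccAddOrder M := ⟨fun _ => rfl⟩

protected theorem mul_lt_mul_of_pos_left {x y z : M} (hz : 0 < z) (h : x < y) :
    z * x < z * y := by
  obtain ⟨w, rfl⟩ := exists_eq_add_add_one h
  rw [add_assoc, mul_add]
  exact lt_add_of_pos_right _ (pos_iff_ne_zero.2 (mul_ne_zero hz.ne' (add_one_ne_zero w)))

scoped instance : IsStrictOrderedRing M where
  le_of_add_le_add_left a b c h := (add_le_add_iff_left a).1 h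
  zero_le_one := zero_le
  mul_lt_mul_of_pos_left _ hz _ _ h := PA.mul_lt_mul_of_pos_left hz h
  mul_lt_mul_of_pos_right z hz x y h := by
    rw [mul_comm x, mul_comm y]
    exact PA.mul_lt_mul_of_pos_left hz h

end Arithmetic

section Coding

section InvertibleMod

variable {R : Type*} [CommSemiring R]

/-- `m` is invertible modulo `k`: coprimality of `m` and `k`, in a form which makes no use of
subtraction. -/
def InvertibleMod (k m : R) : Prop := ∃ x y, m * x = y * k + 1

theorem invertibleMod_one (k : R) : InvertibleMod k 1 :=
  ⟨1, 0, by ring⟩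

theorem InvertibleMod.mul {k m m' : R} (h : InvertibleMod k m) (h' : InvertibleMod k m') :
    InvertibleMod k (m * m') := by
  obtain ⟨x, y, hxy⟩ := h
  obtain ⟨x', y', hxy'⟩ := h'
  refine ⟨x * x', y * y' * k + y + y', ?_⟩
  calc m * m' * (x * x') = (m * x) * (m' * x') := by ring
    _ = (y * y' * k + y + y') * k + 1 := by rw [hxy, hxy']; ring

theorem InvertibleMod.exists_add_mul_eq {k m : R} (h : InvertibleMod (k + 1) m) (a r : R) :
    ∃ u q, a + m * u = q * (k + 1) + r := by
  obtain ⟨x, y, hxy⟩ := h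
  refine ⟨x * (r + a * k), a + y * (r + a * k), ?_⟩
  calc a + m * (x * (r + a * k)) = a + (m * x) * (r + a * k) := by ring
    _ = (a + y * (r + a * k)) * (k + 1) + r := by rw [hxy]; ring

end InvertibleMod

variable {M : Type*} [LPA.Structure M] {α : Type*}

instance DefinableFun.pair (f g : (α → M) → M) [DefinableFun LPA f] [DefinableFun LPA g] :
    DefinableFun LPA fun v => pair (f v) (g v) := by
  unfold PA.pair; infer_instance

instance DefinablePred.elem (f g h : (α → M) → M) [DefinableFun LPA f] [DefinableFun LPA g]
    [DefinableFun LPA h] : DefinablePred LPA fun v => Elem (f v) (g v) (h v) :=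
  .comp₃ (P := PA.Elem) (by unfold PA.Elem; infer_instance) f g h

variable [hM : M ⊨ PeanoArithmetic]

instance DefinablePred.dvd (f g : (α → M) → M) [DefinableFun LPA f] [DefinableFun LPA g] :
    DefinablePred LPA fun v => f v ∣ g v :=
  .comp₂ (P := fun x y : M => x ∣ y) (by simp only [dvd_def]; infer_instance) f g

instance DefinablePred.invertibleMod (f g : (α → M) → M) [DefinableFun LPA f]
    [DefinableFun LPA g] : DefinablePred LPA fun v => InvertibleMod (f v) (g v) :=
  .comp₂ (P := PA.InvertibleMod) (by unfold PA.InvertibleMod; infer_instance) f g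

theorem pair_lt_pair {x y a b : M} (h : x + y < a + b) : pair x y < pair a b := by
  have hsq : (x + y + 1) * (x + y + 1) ≤ (a + b) * (a + b) :=
    mul_self_le_mul_self zero_le (Order.add_one_le_of_lt h)
  calc pair x y = (x + y) * (x + y) + x := rfl
    _ < (x + y) * (x + y) + x + (x + y + y + 1) :=
      lt_add_of_pos_right _ (pos_iff_ne_zero.2 (add_one_ne_zero _))
    _ = (x + y + 1) * (x + y + 1) := by ring
    _ ≤ pair a b := hsq.trans le_self_add

theorem pair_inj {x y a b : M} : pair x y = pair a b ↔ x = a ∧ y = b := by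
  refine ⟨fun h => ?_, by rintro ⟨rfl, rfl⟩; rfl⟩
  have hsum : x + y = a + b := by
    by_contra hne
    obtain hlt | hgt := lt_or_gt_of_ne hne
    exacts [(pair_lt_pair hlt).ne h, (pair_lt_pair hgt).ne' h]
  change (x + y) * (x + y) + x = (a + b) * (a + b) + a at h
  rw [hsum] at h
  obtain rfl := add_left_cancel h
  exact ⟨rfl, add_left_cancel hsum⟩

theorem quotient_le {m q q' r r' : M} (hr' : r' < m) (h : q * m + r = q' * m + r') :
    q ≤ q' := by
  by_contra! hlt
  obtain ⟨e, rfl⟩ := exists_eq_add_add_one hlt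
  have hr'_eq : m + (e * m + r) = r' := by
    refine add_left_cancel (a := q' * m) ?_
    rw [← h]
    ring
  exact (le_self_add.trans_eq hr'_eq).not_gt hr'

theorem remainder_unique {m q q' r r' : M} (hr : r < m) (hr' : r' < m)
    (h : q * m + r = q' * m + r') : r = r' := by
  obtain rfl := le_antisymm (quotient_le hr' h) (quotient_le hr h.symm)
  exact add_left_cancel h

/-- The `i`-th modulus of Gödel's `β`-function with second parameter `b`; see `Elem`. -/
def modulus (b i : M) : M := (i + 1) * b + 1

instance DefinableFun.modulus (f g : (α → M) → M) [DefinableFun LPA f] [DefinableFun LPA g] :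
    DefinableFun LPA fun v => modulus (f v) (g v) := by
  unfold PA.modulus; infer_instance

theorem elem_iff {s i z : M} : Elem s i z ↔
    ∃ a b q, s = pair a b ∧ a = q * modulus b i + z ∧ z < modulus b i := by
  simp only [Elem, modulus, succ_def, add_def, mul_def, lt_def]

theorem Elem.unique {s i z z' : M} (h : Elem s i z) (h' : Elem s i z') : z = z' := by
  obtain ⟨a, b, q, rfl, ha, hz⟩ := elem_iff.1 h
  obtain ⟨a', b', q', hs, ha', hz'⟩ := elem_iff.1 h'
  obtain ⟨rfl, rfl⟩ := pair_inj.1 hs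
  exact remainder_unique hz hz' (ha.symm.trans ha')

theorem invertibleMod_modulus {i d b : M} (hb : 0 < b) (hd : d ∣ b) :
    InvertibleMod (modulus b (i + d)) (modulus b i) := by
  obtain ⟨e, he⟩ := hd
  -- Modulo `modulus b (i + d) = j * b + 1` we have `j * b = -1`, hence
  -- `j * modulus b i = j + (i + 1) * (j * b) = d`, which divides `b`.
  set j := i + d + 1 with hj
  have hjb : 0 < j * b := mul_pos (pos_iff_ne_zero.2 (add_one_ne_zero _)) hb
  obtain ⟨w, hw⟩ := (eq_zero_or_eq_add_one (j * b)).resolve_left hjb.ne'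
  have hsq : (j * b) * (j * b) = w * (j * b + 1) + 1 := by
    rw [hw]
    ring
  refine ⟨j * j * j * e * b, j * j * e * b * (i + 1) + w, ?_⟩
  calc modulus b i * (j * j * j * e * b)
      = j * j * e * b * (i + 1) * (j * b + 1) + (j * j) * (d * e) * b := by
        rw [modulus, hj]; ring
    _ = j * j * e * b * (i + 1) * (j * b + 1) + (j * b) * (j * b) := by rw [← he]; ring
    _ = (j * j * e * b * (i + 1) + w) * modulus b (i + d) + 1 := by rw [hsq, modulus]; ring

theorem exists_common_multiple (c : M) : ∃ L, 0 < L ∧ ∀ d, 0 < d → d ≤ c → d ∣ L := by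
  refine induction_add_one ?_ (fun c ih => ?_) c
  · exact ⟨1, zero_lt_one, fun d hd hd0 => absurd hd hd0.not_gt⟩
  · obtain ⟨L, hL, hdvd⟩ := ih
    refine ⟨(c + 1) * L, mul_pos (pos_iff_ne_zero.2 (add_one_ne_zero c)) hL, fun d hd hdc => ?_⟩
    obtain hlt | rfl := hdc.lt_or_eq
    · exact (hdvd d hd (Order.lt_add_one_iff.1 hlt)).mul_left _
    · exact dvd_mul_right _ _

theorem exists_common_multiple_modulus {b c : M} (hb : 0 < b)
    (hdvd : ∀ d, 0 < d → d ≤ c → d ∣ b) (n : M) :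
    ∃ m, (∀ i < n, modulus b i ∣ m) ∧
      ∀ j, n ≤ j → j ≤ c → InvertibleMod (modulus b j) m := by
  refine induction_add_one ?_ (fun n ih => ?_) n
  · exact ⟨1, fun i hi => absurd hi not_lt_zero, fun j _ _ => invertibleMod_one _⟩
  · obtain ⟨m, hm, hinv⟩ := ih
    refine ⟨m * modulus b n, fun i hi => ?_, fun j hnj hjc => ?_⟩
    · obtain hlt | rfl := (Order.lt_add_one_iff.1 hi).lt_or_eq
      · exact (hm i hlt).mul_right _
      · exact dvd_mul_left _ _
    · have hlt : n < j := Order.add_one_le_iff.1 hnj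
      refine (hinv j hlt.le hjc).mul ?_
      obtain ⟨d, rfl⟩ := exists_add_of_le hlt.le
      exact invertibleMod_modulus hb (hdvd d (pos_of_lt_add_right hlt) (le_add_self.trans hjc))

section DefinableSequences

variable {f : M → M} [hf : DefinableFun LPA fun v : Fin 1 → M => f (v 0)]

include hf

theorem exists_le_of_definable (c : M) : ∃ B, ∀ i ≤ c, f i ≤ B := by
  have definableFun_f {α : Type} (g : (α → M) → M) [DefinableFun LPA g] := hf.comp₁ g
  refine induction_add_one ?_ (fun n ih => ?_) c
  · exact ⟨f 0, fun i hi => (congrArg f (nonpos_iff_eq_zero.1 hi)).le⟩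
  · obtain ⟨B, hB⟩ := ih
    refine ⟨max B (f (n + 1)), fun i hi => ?_⟩
    obtain hlt | rfl := hi.lt_or_eq
    · exact (hB i (Order.lt_add_one_iff.1 hlt)).trans (le_max_left _ _)
    · exact le_max_right _ _

theorem exists_residues_of_definable {b c : M} (hb : 0 < b)
    (hdvd : ∀ d, 0 < d → d ≤ c → d ∣ b) :
    ∃ a, ∀ i ≤ c, ∃ q, a = q * modulus b i + f i := by
  have definableFun_f {α : Type} (g : (α → M) → M) [DefinableFun LPA g] := hf.comp₁ g
  have exists_residues_below (n : M) :
      n ≤ c + 1 → ∃ a, ∀ i < n, ∃ q, a = q * modulus b i + f i := by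
    refine induction_add_one ?_ (fun n ih => ?_) n
    · exact fun _ => ⟨0, fun i hi => absurd hi not_lt_zero⟩
    · intro hn
      have hnc : n < c + 1 := Order.add_one_le_iff.1 hn
      obtain ⟨a, ha⟩ := ih hnc.le
      obtain ⟨m, hm, hinv⟩ := exists_common_multiple_modulus hb hdvd n
      obtain ⟨u, q, huq⟩ :=
        (hinv n le_rfl (Order.lt_add_one_iff.1 hnc)).exists_add_mul_eq a (f n)
      refine ⟨a + m * u, fun i hi => ?_⟩
      obtain hlt | rfl := (Order.lt_add_one_iff.1 hi).lt_or_eq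
      · obtain ⟨q', hq'⟩ := ha i hlt
        obtain ⟨k, rfl⟩ := hm i hlt
        exact ⟨q' + k * u, by rw [hq']; ring⟩
      · exact ⟨q, huq⟩
  obtain ⟨a, ha⟩ := exists_residues_below (c + 1) le_rfl
  exact ⟨a, fun i hi => ha i (Order.lt_add_one_iff.2 hi)⟩

theorem codedSeq_of_definable (c : M) : CodedSeq c f := by
  obtain ⟨B, hB⟩ := exists_le_of_definable (f := f) c
  obtain ⟨L, hL, hdvd⟩ := exists_common_multiple c
  have hb : 0 < L * (B + 1) := mul_pos hL (pos_iff_ne_zero.2 (add_one_ne_zero B))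
  obtain ⟨a, ha⟩ := exists_residues_of_definable (f := f) hb
    fun d hd hdc => (hdvd d hd hdc).mul_right _
  refine ⟨pair a (L * (B + 1)), fun i hi => ?_⟩
  obtain ⟨q, hq⟩ := ha i hi
  refine elem_iff.2 ⟨a, _, q, rfl, hq, Order.lt_add_one_iff.2 ?_⟩
  have one_le_of_pos {x : M} (hx : 0 < x) : 1 ≤ x := by simpa using Order.add_one_le_of_lt hx
  calc f i ≤ B := hB i hi
    _ ≤ B + 1 := le_self_add
    _ ≤ L * (B + 1) := le_mul_of_one_le_left zero_le (one_le_of_pos hL)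
    _ ≤ (i + 1) * (L * (B + 1)) := le_mul_of_one_le_left zero_le le_add_self

end DefinableSequences

open Classical in
/-- The `i`-th element of the sequence coded by `s`, as a total function: it is `0` if `s` does
not code a sequence. -/
noncomputable def nth (s i : M) : M := if h : ∃ z, Elem s i z then h.choose else zero

theorem Elem.nth_eq {s i z : M} (h : Elem s i z) : nth s i = z := by
  have hex : ∃ z, Elem s i z := ⟨z, h⟩
  rw [nth, dif_pos hex]
  exact hex.choose_spec.unique h

theorem nth_eq_iff {s i z : M} :
    nth s i = z ↔ Elem s i z ∨ (¬ ∃ z, Elem s i z) ∧ zero = z := by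
  by_cases h : ∃ z, Elem s i z
  · obtain ⟨w, hw⟩ := h
    have hex : ∃ z, Elem s i z := ⟨w, hw⟩
    rw [hw.nth_eq]
    exact ⟨by rintro rfl; exact .inl hw, fun h => h.elim hw.unique fun h => absurd hex h.1⟩
  · rw [nth, dif_neg h]
    exact ⟨fun hz => .inr ⟨h, hz⟩, fun h' => h'.elim (fun hz => absurd ⟨z, hz⟩ h) And.right⟩

instance DefinableFun.nth (f g : (α → M) → M) [DefinableFun LPA f] [DefinableFun LPA g] :
    DefinableFun LPA fun v => nth (f v) (g v) :=
  .comp₂ (F := PA.nth) (.of_graph (by simp only [nth_eq_iff]; infer_instance)) f g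

theorem CodedSeq.exists_nth_eq {c : M} {f : M → M} (h : CodedSeq c f) :
    ∃ s, ∀ i ≤ c, f i = nth s i :=
  h.imp fun _ hs i hi => (hs i hi).nth_eq.symm

theorem CodedSeq.mono {b c : M} {f : M → M} (hf : CodedSeq c f) (h : b ≤ c) : CodedSeq b f :=
  hf.imp fun _ hs i hi => hs i (le_trans hi h)

theorem CodedSeq.congr {c : M} {f g : M → M} (hf : CodedSeq c f) (h : ∀ i ≤ c, f i = g i) :
    CodedSeq c g :=
  hf.imp fun _ hs i hi => h i hi ▸ hs i hi

end Coding

section BackwardRecursion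

variable {M : Type*} [LPA.Structure M] [hM : M ⊨ PeanoArithmetic]

theorem backward_induction {P : M → Prop} [hP : DefinablePred LPA fun v : Fin 1 → M => P (v 0)]
    {c : M} (last : P c) (step : ∀ i < c, P (i + 1) → P i) : ∀ i ≤ c, P i := by
  have definablePred_P {α : Type} (g : (α → M) → M) [DefinableFun LPA g] := hP.comp₁ g
  have of_add_eq (d : M) : ∀ i, i + d = c → P i := by
    refine induction_add_one ?_ (fun d ih => ?_) d
    · rintro i rfl
      rwa [add_zero] at last
    · intro i hi
      refine step i ?_ (ih (i + 1) (by rw [← hi]; ring))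
      rw [← hi]
      exact lt_add_of_pos_right i (pos_iff_ne_zero.2 (add_one_ne_zero d))
  intro i hi
  obtain ⟨d, rfl⟩ := exists_add_of_le hi
  exact of_add_eq d i rfl

theorem exists_backward_recursion {g : M → M → M}
    [hg : DefinableFun LPA fun v : Fin 2 → M => g (v 0) (v 1)] (b c : M) :
    ∃ d : M → M, CodedSeq c d ∧ d c = b ∧ ∀ i < c, d i = g i (d (i + 1)) := by
  classical
  have definableFun_g {α : Type} (f h : (α → M) → M) [DefinableFun LPA f]
    [DefinableFun LPA h] := hg.comp₂ f h
  have exists_recursion_above : ∀ n ≤ c, ∃ s, nth s c = b ∧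
      ∀ i < c, n ≤ i → nth s i = g i (nth s (i + 1)) := by
    refine backward_induction ?_ fun n hn ih => ?_
    · obtain ⟨s, hs⟩ := (codedSeq_of_definable (f := fun _ => b) c).exists_nth_eq
      exact ⟨s, (hs c le_rfl).symm, fun i hi hci => absurd hi hci.not_gt⟩
    · obtain ⟨s, hlast, hs⟩ := ih
      obtain ⟨s', hs'⟩ := (codedSeq_of_definable
        (f := fun i => if i = n then g n (nth s (n + 1)) else nth s i) c).exists_nth_eq
      have nth_of_gt {i : M} (hi : i ≤ c) (hni : n < i) : nth s' i = nth s i := by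
        rw [← hs' i hi, if_neg hni.ne']
      refine ⟨s', (nth_of_gt le_rfl hn).trans hlast, fun i hi hni => ?_⟩
      have hi' : i + 1 ≤ c := Order.add_one_le_iff.2 hi
      rw [nth_of_gt hi' (Order.lt_add_one_iff.2 hni)]
      obtain hlt | rfl := hni.lt_or_eq
      · rw [nth_of_gt hi.le hlt, hs i hi (Order.add_one_le_iff.2 hlt)]
      · rw [← hs' n hi.le, if_pos rfl]
  obtain ⟨s, hlast, hs⟩ := exists_recursion_above 0 zero_le
  exact ⟨nth s, codedSeq_of_definable c, hlast, fun i hi => hs i hi zero_le⟩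

end BackwardRecursion

section Derivations

variable {M : Type*} [LPA.Structure M] {α : Type*} [hM : M ⊨ PeanoArithmetic]

open Classical in
noncomputable scoped instance : Sub M :=
  ⟨fun x y => if h : y ≤ x then (exists_add_of_le h).choose else 0⟩

theorem add_sub_self_left (x y : M) : x + y - x = y := by
  have h : x ≤ x + y := le_self_add
  change (if h : x ≤ x + y then _ else _) = y
  rw [dif_pos h]
  exact (add_left_cancel (exists_add_of_le h).choose_spec).symm

theorem sub_eq_iff {x y z : M} : x - y = z ↔ x = y + z ∨ x < y ∧ 0 = z := by
  obtain h | h := le_or_gt y x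
  · obtain ⟨w, rfl⟩ := exists_add_of_le h
    rw [add_sub_self_left, add_right_inj]
    exact ⟨.inl, fun hz => hz.resolve_right fun hz => hz.1.not_ge h⟩
  · change (if h : y ≤ x then _ else _) = z ↔ _
    rw [dif_neg h.not_ge]
    exact ⟨fun hz => .inr ⟨h, hz⟩,
      fun hz => (hz.resolve_left fun hz => h.not_ge (hz ▸ le_self_add)).2⟩

instance DefinableFun.hSub (f g : (α → M) → M) [DefinableFun LPA f] [DefinableFun LPA g] :
    DefinableFun LPA fun v => f v - g v :=
  .comp₂ (F := fun x y => x - y) (.of_graph (by simp only [sub_eq_iff]; infer_instance)) f g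

open Classical in
/-- The sequence `f 0, …, f l, g 0, g 1, …`. -/
noncomputable def append (l : M) (f g : M → M) (i : M) : M :=
  if i ≤ l then f i else g (i - (l + 1))

theorem append_of_le {l i : M} {f g : M → M} (hi : i ≤ l) : append l f g i = f i :=
  if_pos hi

theorem append_add_one_add (l k : M) (f g : M → M) : append l f g (l + 1 + k) = g k := by
  have hlt : l < l + 1 + k := (Order.lt_add_one_iff.2 le_rfl).trans_le le_self_add
  rw [append, if_neg hlt.not_ge, add_sub_self_left]

theorem le_or_exists_eq_add_one_add {i l m : M} (hi : i ≤ l + 1 + m) :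
    i ≤ l ∨ ∃ k ≤ m, i = l + 1 + k := by
  obtain h | h := le_or_gt i l
  · exact .inl h
  · obtain ⟨k, rfl⟩ := exists_add_of_le (Order.add_one_le_of_lt h)
    exact .inr ⟨k, (add_le_add_iff_left _).1 hi, rfl⟩

theorem CodedSeq.append {l m : M} {f g : M → M} (hf : CodedSeq l f) (hg : CodedSeq m g) :
    CodedSeq (l + 1 + m) (append l f g) := by
  obtain ⟨s, hs⟩ := hf.exists_nth_eq
  obtain ⟨t, ht⟩ := hg.exists_nth_eq
  have hcoded : CodedSeq (l + 1 + m) (PA.append l (nth s) (nth t)) := by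
    unfold PA.append
    exact codedSeq_of_definable _
  refine hcoded.congr fun i hi => ?_
  obtain hil | ⟨k, hk, rfl⟩ := le_or_exists_eq_add_one_add hi
  · rw [append_of_le hil, append_of_le hil, hs i hil]
  · rw [append_add_one_add, append_add_one_add, ht k hk]

/-- `f 0, …, f l` is a derivation by the rules `step`: each term is obtained from earlier ones. -/
def IsDerivation (step : (M → Prop) → M → Prop) (l : M) (f : M → M) : Prop :=
  ∀ i ≤ l, step (fun z => ∃ j < i, f j = z) (f i)

variable {step : (M → Prop) → M → Prop}

theorem isDerivation_iff_of_code {s l : M} {f : M → M} (hs : ∀ i ≤ l, Elem s i (f i)) :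
    IsDerivation step l f ↔
      ∀ i ≤ l, ∃ y, Elem s i y ∧ step (fun z => ∃ j, lt j i ∧ Elem s j z) y := by
  refine forall₂_congr fun i hi => ?_
  have earlier_eq : (fun z => ∃ j < i, f j = z) = fun z => ∃ j, lt j i ∧ Elem s j z := by
    funext z
    refine propext (exists_congr fun j => and_congr_right fun hj => ?_)
    have hsj := hs j (le_trans (le_of_lt hj) hi)
    exact ⟨fun h => h ▸ hsj, hsj.unique⟩
  rw [earlier_eq]
  refine ⟨fun h => ⟨f i, hs i hi, h⟩, ?_⟩
  rintro ⟨y, hy, h⟩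
  rwa [(hs i hi).unique hy]

theorem gen_iff {x : M} :
    Gen step x ↔ ∃ l f, CodedSeq l f ∧ IsDerivation step l f ∧ f l = x := by
  constructor
  · rintro ⟨s, l, hl, h⟩
    have hs (i : M) (hi : i ≤ l) : Elem s i (nth s i) := by
      obtain ⟨y, hy, -⟩ := h i hi
      rwa [hy.nth_eq]
    exact ⟨l, nth s, ⟨s, hs⟩, (isDerivation_iff_of_code hs).2 h, hl.nth_eq⟩
  · rintro ⟨l, f, ⟨s, hs⟩, hder, rfl⟩
    exact ⟨s, l, hs l ((le_def l l).2 le_rfl), (isDerivation_iff_of_code hs).1 hder⟩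

theorem IsDerivation.append (hstep : Monotone step) {l m : M} {f g : M → M}
    (hf : IsDerivation step l f)
    (hg : ∀ k ≤ m, step (fun z => (∃ j ≤ l, f j = z) ∨ ∃ j < k, g j = z) (g k)) :
    IsDerivation step (l + 1 + m) (append l f g) := by
  intro i hi
  obtain hil | ⟨k, hk, rfl⟩ := le_or_exists_eq_add_one_add hi
  · rw [append_of_le hil]
    refine hstep ?_ _ (hf i hil)
    rintro _ ⟨j, hj, rfl⟩
    exact ⟨j, hj, append_of_le (hj.le.trans hil)⟩
  · rw [append_add_one_add]
    refine hstep ?_ _ (hg k hk)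
    rintro _ (⟨j, hj, rfl⟩ | ⟨j, hj, rfl⟩)
    · exact ⟨j, (Order.lt_add_one_iff.2 hj).trans_le le_self_add, append_of_le hj⟩
    · exact ⟨l + 1 + j, (add_lt_add_iff_left _).2 hj, append_add_one_add ..⟩

theorem Gen.cases (hstep : Monotone step) {y : M} (h : Gen step y) : step (Gen step) y := by
  obtain ⟨l, f, hf, hder, rfl⟩ := gen_iff.1 h
  refine hstep ?_ _ (hder l le_rfl)
  rintro _ ⟨j, hj, rfl⟩
  exact gen_iff.2 ⟨j, f, hf.mono hj.le, fun i hi => hder i (hi.trans hj.le), rfl⟩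

theorem Gen.intro (hstep : Monotone step) {a b y : M} (ha : Gen step a) (hb : Gen step b)
    (hy : step (fun z => z = a ∨ z = b) y) : Gen step y := by
  obtain ⟨l, f, hf, hfder, rfl⟩ := gen_iff.1 ha
  obtain ⟨m, g, hg, hgder, rfl⟩ := gen_iff.1 hb
  have hder : IsDerivation step (l + 1 + m) (append l f g) :=
    hfder.append hstep fun k hk => hstep (fun _ => .inr) _ (hgder k hk)
  have hder' : IsDerivation step (l + 1 + m + 1 + 0)
      (append (l + 1 + m) (append l f g) fun _ => y) := by
    refine hder.append hstep fun _ _ => hstep ?_ _ hy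
    rintro _ (rfl | rfl)
    · exact .inl ⟨l, add_assoc l 1 m ▸ le_self_add, append_of_le le_rfl⟩
    · exact .inl ⟨l + 1 + m, le_rfl, append_add_one_add ..⟩
  exact gen_iff.2 ⟨_, _, (hf.append hg).append (codedSeq_of_definable 0), hder',
    append_add_one_add ..⟩

end Derivations

section Syntactic

variable {M : Type*} [LPA.Structure M] {α : Type*}

instance DefinableFun.cVar (f : (α → M) → M) [DefinableFun LPA f] :
    DefinableFun LPA fun v => cVar (f v) := by
  unfold PA.cVar; infer_instance

instance DefinableFun.cSucc (f : (α → M) → M) [DefinableFun LPA f] :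
    DefinableFun LPA fun v => cSucc (f v) := by
  unfold PA.cSucc; infer_instance

instance DefinableFun.cAdd (f g : (α → M) → M) [DefinableFun LPA f] [DefinableFun LPA g] :
    DefinableFun LPA fun v => cAdd (f v) (g v) := by
  unfold PA.cAdd; infer_instance

instance DefinableFun.cMul (f g : (α → M) → M) [DefinableFun LPA f] [DefinableFun LPA g] :
    DefinableFun LPA fun v => cMul (f v) (g v) := by
  unfold PA.cMul; infer_instance

instance DefinableFun.cEq (f g : (α → M) → M) [DefinableFun LPA f] [DefinableFun LPA g] :
    DefinableFun LPA fun v => cEq (f v) (g v) := by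
  unfold PA.cEq; infer_instance

instance DefinableFun.cNeg (f : (α → M) → M) [DefinableFun LPA f] :
    DefinableFun LPA fun v => cNeg (f v) := by
  unfold PA.cNeg; infer_instance

instance DefinableFun.cOr (f g : (α → M) → M) [DefinableFun LPA f] [DefinableFun LPA g] :
    DefinableFun LPA fun v => cOr (f v) (g v) := by
  unfold PA.cOr; infer_instance

instance DefinableFun.cEx (f g : (α → M) → M) [DefinableFun LPA f] [DefinableFun LPA g] :
    DefinableFun LPA fun v => cEx (f v) (g v) := by
  unfold PA.cEx; infer_instance

instance DefinableFun.cAnd (f g : (α → M) → M) [DefinableFun LPA f] [DefinableFun LPA g] :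
    DefinableFun LPA fun v => cAnd (f v) (g v) := by
  unfold PA.cAnd; infer_instance

instance DefinableFun.cImp (f g : (α → M) → M) [DefinableFun LPA f] [DefinableFun LPA g] :
    DefinableFun LPA fun v => cImp (f v) (g v) := by
  unfold PA.cImp; infer_instance

instance DefinablePred.isTerm (f : (α → M) → M) [DefinableFun LPA f] :
    DefinablePred LPA fun v => IsTerm (f v) :=
  .comp₁ (P := PA.IsTerm) (by unfold PA.IsTerm Gen; infer_instance) f

instance DefinablePred.occursIn (f g : (α → M) → M) [DefinableFun LPA f] [DefinableFun LPA g] :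
    DefinablePred LPA fun v => OccursIn (f v) (g v) :=
  .comp₂ (P := PA.OccursIn) (by unfold PA.OccursIn Gen; infer_instance) f g

instance DefinablePred.isForm (f : (α → M) → M) [DefinableFun LPA f] :
    DefinablePred LPA fun v => IsForm (f v) :=
  .comp₁ (P := PA.IsForm) (by unfold PA.IsForm Gen; infer_instance) f

instance DefinablePred.freeIn (f g : (α → M) → M) [DefinableFun LPA f] [DefinableFun LPA g] :
    DefinablePred LPA fun v => FreeIn (f v) (g v) :=
  .comp₂ (P := PA.FreeIn) (by unfold PA.FreeIn Gen; infer_instance) f g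

instance DefinablePred.isSent (f : (α → M) → M) [DefinableFun LPA f] :
    DefinablePred LPA fun v => IsSent (f v) :=
  .comp₁ (P := PA.IsSent) (by unfold PA.IsSent; infer_instance) f

theorem monotone_isForm_step : Monotone fun (P : M → Prop) y =>
    (∃ t u, IsTerm t ∧ IsTerm u ∧ y = cEq t u) ∨ (∃ φ, P φ ∧ y = cNeg φ) ∨
      (∃ φ ψ, P φ ∧ P ψ ∧ y = cOr φ ψ) ∨ (∃ v φ, P φ ∧ y = cEx v φ) := by
  intro P Q h y
  change _ → _
  gcongr <;> exact h _

theorem monotone_freeIn_step (v : M) : Monotone fun (P : M → Prop) y =>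
    (∃ t u, (OccursIn v t ∨ OccursIn v u) ∧ y = cEq t u) ∨
      (∃ φ, P φ ∧ y = cNeg φ) ∨ (∃ φ ψ, (P φ ∨ P ψ) ∧ y = cOr φ ψ) ∨
      (∃ w φ, w ≠ v ∧ P φ ∧ y = cEx w φ) := by
  intro P Q h y
  change _ → _
  gcongr <;> exact h _

variable [hM : M ⊨ PeanoArithmetic]

theorem std_injective : Function.Injective (std : ℕ → M) := fun m n h => by
  rwa [std_eq_natCast, std_eq_natCast, Nat.cast_inj] at h

theorem tag_injective {m n : ℕ} {x y : M} (h : pair (std m) x = pair (std n) y) : m = n :=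
  std_injective (pair_inj.1 h).1

theorem cNeg_inj {φ ψ : M} : cNeg φ = cNeg ψ ↔ φ = ψ := by
  simp only [cNeg, pair_inj, true_and]

theorem cOr_inj {φ ψ φ' ψ' : M} : cOr φ ψ = cOr φ' ψ' ↔ φ = φ' ∧ ψ = ψ' := by
  simp only [cOr, pair_inj, true_and]

theorem IsForm.neg {φ : M} (h : IsForm φ) : IsForm (cNeg φ) :=
  Gen.intro monotone_isForm_step h h (.inr (.inl ⟨φ, .inl rfl, rfl⟩))

theorem IsForm.or {φ ψ : M} (h : IsForm φ) (h' : IsForm ψ) : IsForm (cOr φ ψ) :=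
  Gen.intro monotone_isForm_step h h' (.inr (.inr (.inl ⟨φ, ψ, .inl rfl, .inr rfl, rfl⟩)))

theorem FreeIn.of_neg {v φ : M} (h : FreeIn v (cNeg φ)) : FreeIn v φ := by
  obtain ⟨_, _, _, heq⟩ | ⟨ψ, hψ, heq⟩ | ⟨_, _, _, heq⟩ | ⟨_, _, _, _, heq⟩ :=
    h.cases (monotone_freeIn_step v)
  · exact absurd (tag_injective heq) (by decide)
  · obtain rfl := cNeg_inj.1 heq
    exact hψ
  · exact absurd (tag_injective heq) (by decide)
  · exact absurd (tag_injective heq) (by decide)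

theorem FreeIn.of_or {v φ ψ : M} (h : FreeIn v (cOr φ ψ)) : FreeIn v φ ∨ FreeIn v ψ := by
  obtain ⟨_, _, _, heq⟩ | ⟨_, _, heq⟩ | ⟨_, _, h', heq⟩ | ⟨_, _, _, _, heq⟩ :=
    h.cases (monotone_freeIn_step v)
  · exact absurd (tag_injective heq) (by decide)
  · exact absurd (tag_injective heq) (by decide)
  · obtain ⟨rfl, rfl⟩ := cOr_inj.1 heq
    exact h'
  · exact absurd (tag_injective heq) (by decide)

theorem IsSent.neg {φ : M} (h : IsSent φ) : IsSent (cNeg φ) :=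
  ⟨h.1.neg, fun v hv => h.2 v hv.of_neg⟩

theorem IsSent.or {φ ψ : M} (h : IsSent φ) (h' : IsSent ψ) : IsSent (cOr φ ψ) :=
  ⟨h.1.or h'.1, fun v hv => hv.of_or.elim (h.2 v) (h'.2 v)⟩

theorem IsSent.and {φ ψ : M} (h : IsSent φ) (h' : IsSent ψ) : IsSent (cAnd φ ψ) :=
  (h.neg.or h'.neg).neg

theorem IsSent.imp {φ ψ : M} (h : IsSent φ) (h' : IsSent ψ) : IsSent (cImp φ ψ) :=
  h.neg.or h'

end Syntactic

section Truth

variable {M : Type*} [LPA.Structure M]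

/-- `T` commutes with the propositional connectives on the sentences of `M`: the only clauses of
`CT⁻` which matter for propositional combinations of sentences. -/
structure IsPropTruth (T : Set M) : Prop where
  neg : ∀ φ : M, IsSent φ → (cNeg φ ∈ T ↔ φ ∉ T)
  or : ∀ φ ψ : M, IsSent φ → IsSent ψ → (cOr φ ψ ∈ T ↔ φ ∈ T ∨ ψ ∈ T)

theorem IsCTMinus.isPropTruth {T : Set M} (hT : IsCTMinus M T) : IsPropTruth T :=
  ⟨hT.neg, hT.or⟩

variable [hM : M ⊨ PeanoArithmetic]

namespace IsPropTruth

variable {T : Set M} {φ ψ : M}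

theorem and_iff (hT : IsPropTruth T) (hφ : IsSent φ) (hψ : IsSent ψ) :
    cAnd φ ψ ∈ T ↔ φ ∈ T ∧ ψ ∈ T := by
  rw [cAnd, hT.neg _ (hφ.neg.or hψ.neg), hT.or _ _ hφ.neg hψ.neg, hT.neg _ hφ, hT.neg _ hψ]
  tauto

theorem imp_iff (hT : IsPropTruth T) (hφ : IsSent φ) (hψ : IsSent ψ) :
    cImp φ ψ ∈ T ↔ (φ ∈ T → ψ ∈ T) := by
  rw [cImp, hT.or _ _ hφ.neg hψ, hT.neg _ hφ, imp_iff_not_or]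

end IsPropTruth

end Truth

section StoppingDisj

variable {M : Type*} [LPA.Structure M] {α : Type*}

/-- The sentence `(φ → ψ) ∧ ((φ ∧ ψ) ∨ (¬ φ ∧ δ))` by which the disjunction with stopping
condition `δ` is extended by one more pair `φ, ψ`. -/
def stoppingStep (φ ψ δ : M) : M :=
  cAnd (cImp φ ψ) (cOr (cAnd φ ψ) (cAnd (cNeg φ) δ))

instance DefinableFun.stoppingStep (f g h : (α → M) → M) [DefinableFun LPA f]
    [DefinableFun LPA g] [DefinableFun LPA h] :
    DefinableFun LPA fun v => stoppingStep (f v) (g v) (h v) := by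
  unfold PA.stoppingStep; infer_instance

/-- `d` is the sequence of the disjunctions with stopping condition `⋁_{i=a}^{c,α} β_i`, for
`a ≤ c`. -/
structure IsStoppingSeq (c : M) (α β d : M → M) : Prop where
  coded : CodedSeq c d
  last : d c = cAnd (α c) (β c)
  step : ∀ i, lt i c → d i = stoppingStep (α i) (β i) (d (succ i))

theorem isStoppingDisj_iff {c : M} {α β : M → M} {a δ : M} :
    IsStoppingDisj c α β a δ ↔ ∃ d, IsStoppingSeq c α β d ∧ d a = δ :=
  ⟨fun ⟨d, hcoded, hlast, hstep, hδ⟩ => ⟨d, ⟨hcoded, hlast, hstep⟩, hδ⟩,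
    fun ⟨d, ⟨hcoded, hlast, hstep⟩, hδ⟩ => ⟨d, hcoded, hlast, hstep, hδ⟩⟩

variable [hM : M ⊨ PeanoArithmetic]

theorem IsSent.stoppingStep {φ ψ δ : M} (hφ : IsSent φ) (hψ : IsSent ψ) (hδ : IsSent δ) :
    IsSent (stoppingStep φ ψ δ) :=
  (hφ.imp hψ).and ((hφ.and hψ).or (hφ.neg.and hδ))

theorem IsPropTruth.stoppingStep_iff {T : Set M} (hT : IsPropTruth T) {φ ψ δ : M}
    (hφ : IsSent φ) (hψ : IsSent ψ) (hδ : IsSent δ) :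
    stoppingStep φ ψ δ ∈ T ↔ (φ ∈ T ∧ ψ ∈ T) ∨ (φ ∉ T ∧ δ ∈ T) := by
  rw [stoppingStep, hT.and_iff (hφ.imp hψ) ((hφ.and hψ).or (hφ.neg.and hδ)),
    hT.imp_iff hφ hψ, hT.or _ _ (hφ.and hψ) (hφ.neg.and hδ), hT.and_iff hφ hψ,
    hT.and_iff hφ.neg hδ, hT.neg _ hφ]
  tauto

variable {c : M} {α β d d' : M → M}

theorem exists_isStoppingSeq (hα : CodedSeq c α) (hβ : CodedSeq c β) :
    ∃ d, IsStoppingSeq c α β d := by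
  obtain ⟨s, hs⟩ := hα.exists_nth_eq
  obtain ⟨t, ht⟩ := hβ.exists_nth_eq
  obtain ⟨d, hd, hlast, hstep⟩ := exists_backward_recursion
    (g := fun i x => stoppingStep (nth s i) (nth t i) x) (cAnd (α c) (β c)) c
  refine ⟨d, hd, hlast, fun i (hi : i < c) => ?_⟩
  rw [hs i hi.le, ht i hi.le, succ_def]
  exact hstep i hi

namespace IsStoppingSeq

theorem eq_step (hd : IsStoppingSeq c α β d) {i : M} (hi : i < c) :
    d i = stoppingStep (α i) (β i) (d (i + 1)) :=
  succ_def i ▸ hd.step i hi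

theorem unique (hd : IsStoppingSeq c α β d) (hd' : IsStoppingSeq c α β d') :
    ∀ i ≤ c, d i = d' i := by
  obtain ⟨s, hs⟩ := hd.coded.exists_nth_eq
  obtain ⟨s', hs'⟩ := hd'.coded.exists_nth_eq
  have nth_eq_nth : ∀ i ≤ c, nth s i = nth s' i := by
    refine backward_induction ?_ fun i hi ih => ?_
    · rw [← hs c le_rfl, ← hs' c le_rfl, hd.last, hd'.last]
    · have hi' : i + 1 ≤ c := Order.add_one_le_of_lt hi
      rw [← hs i hi.le, ← hs' i hi.le, hd.eq_step hi, hd'.eq_step hi, hs _ hi', hs' _ hi', ih]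
  intro i hi
  rw [hs i hi, hs' i hi, nth_eq_nth i hi]

theorem isSent (hd : IsStoppingSeq c α β d) (hα : ∀ i ≤ c, IsSent (α i))
    (hβ : ∀ i ≤ c, IsSent (β i)) : ∀ i ≤ c, IsSent (d i) := by
  obtain ⟨s, hs⟩ := hd.coded.exists_nth_eq
  have isSent_nth : ∀ i ≤ c, IsSent (nth s i) := by
    refine backward_induction ?_ fun i hi ih => ?_
    · rw [← hs c le_rfl, hd.last]
      exact (hα c le_rfl).and (hβ c le_rfl)
    · rw [← hs i hi.le, hd.eq_step hi, hs _ (Order.add_one_le_of_lt hi)]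
      exact (hα i hi.le).stoppingStep (hβ i hi.le) ih
  intro i hi
  rw [hs i hi]
  exact isSent_nth i hi

variable {T : Set M}

theorem mem_iff_of_mem (hd : IsStoppingSeq c α β d) (hT : IsPropTruth T)
    (hα : ∀ i ≤ c, IsSent (α i)) (hβ : ∀ i ≤ c, IsSent (β i)) {i : M} (hi : i ≤ c)
    (hαi : α i ∈ T) : d i ∈ T ↔ β i ∈ T := by
  obtain hlt | rfl := hi.lt_or_eq
  · rw [hd.eq_step hlt, hT.stoppingStep_iff (hα i hi) (hβ i hi)
      (hd.isSent hα hβ _ (Order.add_one_le_of_lt hlt))]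
    simp only [hαi, true_and, not_true, false_and, or_false]
  · rw [hd.last, hT.and_iff (hα i hi) (hβ i hi), and_iff_right hαi]

theorem mem_iff_of_notMem (hd : IsStoppingSeq c α β d) (hT : IsPropTruth T)
    (hα : ∀ i ≤ c, IsSent (α i)) (hβ : ∀ i ≤ c, IsSent (β i)) {i : M} (hi : i < c)
    (hαi : α i ∉ T) : d i ∈ T ↔ d (i + 1) ∈ T := by
  rw [hd.eq_step hi, hT.stoppingStep_iff (hα i hi.le) (hβ i hi.le)
    (hd.isSent hα hβ _ (Order.add_one_le_of_lt hi))]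
  simp only [hαi, false_and, not_false_eq_true, true_and, false_or]

-- `T` need not satisfy induction in `M`, hence the induction on the standard number `n`.
theorem mem_zero_iff_mem_natCast (hd : IsStoppingSeq c α β d) (hT : IsPropTruth T)
    (hα : ∀ i ≤ c, IsSent (α i)) (hβ : ∀ i ≤ c, IsSent (β i)) :
    ∀ {n : ℕ}, (n : M) ≤ c → (∀ i < (n : M), α i ∉ T) → (d 0 ∈ T ↔ d n ∈ T)
  | 0, _, _ => by rw [Nat.cast_zero]
  | n + 1, hn, hmin => by
    rw [Nat.cast_succ] at hn hmin ⊢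
    have hlt : (n : M) < n + 1 := Order.lt_add_one_iff.2 le_rfl
    rw [hd.mem_zero_iff_mem_natCast hT hα hβ (hlt.le.trans hn) fun i hi => hmin i (hi.trans hlt)]
    exact hd.mem_iff_of_notMem hT hα hβ (hlt.trans_le hn) (hmin _ hlt)

end IsStoppingSeq

theorem existsUnique_isStoppingDisj (hα : CodedSeq c α) (hβ : CodedSeq c β) {a : M}
    (ha : a ≤ c) : ∃! δ, IsStoppingDisj c α β a δ := by
  obtain ⟨d, hd⟩ := exists_isStoppingSeq hα hβ
  refine ⟨d a, isStoppingDisj_iff.2 ⟨d, hd, rfl⟩, fun δ hδ => ?_⟩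
  obtain ⟨d', hd', rfl⟩ := isStoppingDisj_iff.1 hδ
  exact hd'.unique hd a ha

theorem IsStoppingDisj.mem_iff {T : Set M} (hT : IsPropTruth T) (hα : ∀ i ≤ c, IsSent (α i))
    (hβ : ∀ i ≤ c, IsSent (β i)) {k₀ δ : M} (hδ : IsStoppingDisj c α β 0 δ) (hk₀c : k₀ ≤ c)
    (hk₀ : α k₀ ∈ T) (hmin : ∀ i < k₀, α i ∉ T) (hstd : IsStandard k₀) :
    δ ∈ T ↔ β k₀ ∈ T := by
  obtain ⟨d, hd, rfl⟩ := isStoppingDisj_iff.1 hδ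
  obtain ⟨n, rfl⟩ := hstd
  rw [std_eq_natCast] at *
  rw [hd.mem_zero_iff_mem_natCast hT hα hβ hk₀c hmin, hd.mem_iff_of_mem hT hα hβ hk₀c hk₀]

end StoppingDisj

end PA

theorem mainTheorem1_general {M : Type u} [LPA.Structure M] [M ⊨ PeanoArithmetic] (T : Set M)
    (hT : PA.IsPropTruth T) (c : M) (α β : M → M)
    (hα : PA.CodedSeq c α) (hαs : ∀ i, PA.le i c → PA.IsSent (α i))
    (hβ : PA.CodedSeq c β) (hβs : ∀ i, PA.le i c → PA.IsSent (β i))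
    (k₀ : M) (hk₀c : PA.le k₀ c) (hk₀ : α k₀ ∈ T) (hmin : ∀ i, PA.lt i k₀ → α i ∉ T)
    (hstd : PA.IsStandard k₀) :
    (∀ a, PA.le a c → ∃! δ, PA.IsStoppingDisj c α β a δ) ∧
      ∀ δ, PA.IsStoppingDisj c α β PA.zero δ → (δ ∈ T ↔ β k₀ ∈ T) :=
  ⟨fun _ => PA.existsUnique_isStoppingDisj hα hβ,
    fun _ hδ => hδ.mem_iff hT hαs hβs hk₀c hk₀ hmin hstd⟩

theorem mainTheorem1 {M : Type u} [LPA.Structure M] (T : Set M) (hT : PA.IsCTMinus M T)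
    (c : M) (α β : M → M)
    (hα : PA.CodedSeq c α) (hαs : ∀ i, PA.le i c → PA.IsSent (α i))
    (hβ : PA.CodedSeq c β) (hβs : ∀ i, PA.le i c → PA.IsSent (β i))
    (k₀ : M) (hk₀c : PA.le k₀ c) (hk₀ : α k₀ ∈ T) (hmin : ∀ i, PA.lt i k₀ → α i ∉ T)
    (hstd : PA.IsStandard k₀) :
    (∀ a, PA.le a c → ∃! δ, PA.IsStoppingDisj c α β a δ) ∧
      ∀ δ, PA.IsStoppingDisj c α β PA.zero δ → (δ ∈ T ↔ β k₀ ∈ T) := by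
  have := hT.pa
  exact mainTheorem1_general T hT.isPropTruth c α β hα hαs hβ hβs k₀ hk₀c hk₀ hmin hstd
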